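/- Let $G=(V,E)$ be a (simple, undirected) connected graph whose vertex set is countable (finite or infinite). Then the topological space $\mathrm{ETOP}(G)$, defined as follows, is compact. Regard $G$ as a 1-complex, every edge being a copy of the interval $[0,1]$. A *ray* is a one-way infinite path in $G$. Two rays are *edge-equivalent* if no finite set of edges separates them, i.e. if for every finite $S\subseteq E$ they have tails in the same component of $G-S$. The equivalence classes are the *edge-ends* of $G$; their set is denoted by $\Omega'(G)$. Let $\mathrm{ETOP}'(G)$ be the set $G\cup\Omega'(G)$ with the topology generated by the following sets: 1. for every edge $e$, the subsets of the interior of $e$ that correspond to open subsets of $(0,1)$; 2. for every finite $S\subseteq E$ and every component $C$ of $G-S$, all sets of the form $C\cup\Omega'(C)\cup E'(C)$, where $\Omega'(C)$ is the set of edge-ends of $G$ that have a ray in $C$, and $E'(C)$ is any union of half-edges $(z,y]\subset e$ with $z$ an inner point of $e$, one for every edge $e\in S$ and every endvertex $y$ of $e$ that lies in $C$. The space $\mathrm{ETOP}(G)$ is the quotient of $\mathrm{ETOP}'(G)$ obtained by identifying any two points that have the same open neighbourhoods. -/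

import Mathlib

namespace EdgeTop

variable {V : Type*}

/-- A ray (one-way infinite path) of `G`, given by the sequence of its vertices from its
first vertex on. -/
structure Ray (G : SimpleGraph V) where
  vert : ℕ → V
  injective : Function.Injective vert
  adj : ∀ n, G.Adj (vert n) (vert (n + 1))

/-- The tail of a ray that starts at its `k`-th vertex. -/
def Ray.tail {G : SimpleGraph V} (r : Ray G) (k : ℕ) : Ray G where
  vert n := r.vert (k + n)
  injective _ _ h := Nat.add_left_cancel (r.injective h)
  adj n := r.adj (k + n)

/-- The ray `r` is contained in the component `C` of `G - S`: all its vertices lie in `C`, and all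
its edges are edges of `G - S`. -/
def Ray.LiesIn {G : SimpleGraph V} (r : Ray G) {S : Set (Sym2 V)}
    (C : (G.deleteEdges S).ConnectedComponent) : Prop :=
  (∀ n, r.vert n ∈ C.supp) ∧ ∀ n, (G.deleteEdges S).Adj (r.vert n) (r.vert (n + 1))

/-- Two rays are edge-equivalent if no finite set `S` of edges separates them, that is, if for
every such `S` they have tails in the same component of `G - S`. -/
def Ray.EdgeEquiv {G : SimpleGraph V} (r r' : Ray G) : Prop :=
  ∀ S : Set (Sym2 V), S.Finite → S ⊆ G.edgeSet →
    ∃ C : (G.deleteEdges S).ConnectedComponent,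
      (∃ k, (r.tail k).LiesIn C) ∧ (∃ k, (r'.tail k).LiesIn C)

theorem Ray.exists_tail_liesIn {G : SimpleGraph V} (r : Ray G) {S : Set (Sym2 V)}
    (hS : S.Finite) :
    ∃ C : (G.deleteEdges S).ConnectedComponent, ∃ k, (r.tail k).LiesIn C := by
  have hinj : Function.Injective (fun n => s(r.vert n, r.vert (n + 1))) := by
    intro m n h
    rcases Sym2.eq_iff.1 h with ⟨h, -⟩ | ⟨h, h'⟩
    · exact r.injective h
    · have h1 := r.injective h
      have h2 := r.injective h'
      omega
  obtain ⟨k, hk⟩ := (hS.preimage hinj.injOn).bddAbove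
  have hadj : ∀ n, (G.deleteEdges S).Adj ((r.tail (k + 1)).vert n)
      ((r.tail (k + 1)).vert (n + 1)) := by
    intro n
    rw [SimpleGraph.deleteEdges_adj]
    refine ⟨(r.tail (k + 1)).adj n, fun hmem => ?_⟩
    have : k + 1 + n ≤ k := hk hmem
    omega
  refine ⟨(G.deleteEdges S).connectedComponentMk ((r.tail (k + 1)).vert 0), k + 1, ?_, hadj⟩
  intro n
  induction n with
  | zero => rfl
  | succ n ih => exact (SimpleGraph.ConnectedComponent.sound (hadj n).symm.reachable).trans ih

theorem Ray.liesIn_unique {G : SimpleGraph V} (r : Ray G) {S : Set (Sym2 V)}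
    {C D : (G.deleteEdges S).ConnectedComponent} {k l : ℕ}
    (hC : (r.tail k).LiesIn C) (hD : (r.tail l).LiesIn D) : C = D := by
  have h1 : (G.deleteEdges S).connectedComponentMk (r.vert (k + l)) = C := hC.1 l
  have h2 : (G.deleteEdges S).connectedComponentMk (r.vert (l + k)) = D := hD.1 k
  rw [← h1, ← h2, add_comm]

/-- Edge-equivalence of rays as a setoid. -/
def raySetoid (G : SimpleGraph V) : Setoid (Ray G) where
  r := Ray.EdgeEquiv
  iseqv :=
    { refl := fun r S hS _ => by
        obtain ⟨C, h⟩ := r.exists_tail_liesIn hS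
        exact ⟨C, h, h⟩
      symm := fun h S hS hSG => by
        obtain ⟨C, h1, h2⟩ := h S hS hSG
        exact ⟨C, h2, h1⟩
      trans := fun {_ y _} hxy hyz S hS hSG => by
        obtain ⟨C, h1, k, h2⟩ := hxy S hS hSG
        obtain ⟨D, ⟨l, h3⟩, h4⟩ := hyz S hS hSG
        obtain rfl := y.liesIn_unique h2 h3
        exact ⟨C, h1, h4⟩ }

/-- The edge-ends of `G`: the classes of edge-equivalent rays. -/
def EdgeEnd (G : SimpleGraph V) : Type _ := Quotient (raySetoid G)

/-- The edge-end that contains the ray `r`. -/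
def Ray.toEnd {G : SimpleGraph V} (r : Ray G) : EdgeEnd G := Quotient.mk (raySetoid G) r

/-- Every edge is identified with the unit interval; this is its endvertex at the parameter `0`. -/
noncomputable def vertexAtZero {G : SimpleGraph V} (e : G.edgeSet) : V := (Quot.out e.1).1

/-- The endvertex of the edge `e` at the parameter `1`. -/
noncomputable def vertexAtOne {G : SimpleGraph V} (e : G.edgeSet) : V := (Quot.out e.1).2

theorem mk_vertexAtZero_vertexAtOne {G : SimpleGraph V} (e : G.edgeSet) :
    s(vertexAtZero e, vertexAtOne e) = e.1 := Quot.out_eq e.1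

/-- The points of the 1-complex `G`, which are the vertices and the inner points of edges,
together with the edge-ends of `G`. -/
inductive Point (G : SimpleGraph V) : Type _
  | vertex (v : V) : Point G
  | inner (e : G.edgeSet) (t : Set.Ioo (0 : ℝ) 1) : Point G
  | edgeEnd (w : EdgeEnd G) : Point G

/-- The set of inner points of `e` with parameter in `U`. -/
def edgeOpen {G : SimpleGraph V} (e : G.edgeSet) (U : Set (Set.Ioo (0 : ℝ) 1)) :
    Set (Point G) :=
  {p | ∃ t ∈ U, p = Point.inner e t}

/-- The set `C ∪ Ω'(C) ∪ E'(C)` for a component `C` of `G - S`. It consists of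
* the vertices of `C`;
* the inner points of the edges of `C`, which are the edges outside `S` with an endvertex in `C`
  (and so with both);
* for every edge `e` in `S` and each endvertex `y` of `e` in `C`, the inner points of a half-edge
  `(z, y]` of `e`, where `z` has the parameter `a e` if `y` is the endvertex at `0`, and the
  parameter `b e` if `y` is the endvertex at `1`;
* the edge-ends that have a ray in `C`. -/
def componentOpen {G : SimpleGraph V} {S : Set (Sym2 V)}
    (C : (G.deleteEdges S).ConnectedComponent) (a b : G.edgeSet → Set.Ioo (0 : ℝ) 1) :
    Set (Point G) :=
  {p | match p with
    | Point.vertex v => v ∈ C.supp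
    | Point.inner e t =>
        (e.1 ∉ S ∧ vertexAtZero e ∈ C.supp) ∨
        (e.1 ∈ S ∧ ((vertexAtZero e ∈ C.supp ∧ t < a e) ∨ (vertexAtOne e ∈ C.supp ∧ b e < t)))
    | Point.edgeEnd w => ∃ r : Ray G, r.toEnd = w ∧ r.LiesIn C}

/-- The topology of `ETOP'(G)`, generated by the open sets of open edges and the sets
`C ∪ Ω'(C) ∪ E'(C)` for the components `C` of `G - S`, where `S` is a finite set of edges. -/
instance instTopologicalSpacePoint (G : SimpleGraph V) : TopologicalSpace (Point G) :=
  TopologicalSpace.generateFrom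
    ({O | ∃ (e : G.edgeSet) (U : Set (Set.Ioo (0 : ℝ) 1)), IsOpen U ∧ O = edgeOpen e U} ∪
      {O | ∃ S : Set (Sym2 V), S.Finite ∧ S ⊆ G.edgeSet ∧
        ∃ (C : (G.deleteEdges S).ConnectedComponent) (a b : G.edgeSet → Set.Ioo (0 : ℝ) 1),
          O = componentOpen C a b})

/-- The space `ETOP(G)`, obtained from `ETOP'(G)` by identifying any two points that have the same
open neighbourhoods; it carries the quotient topology. -/
abbrev ETOP (G : SimpleGraph V) : Type _ := SeparationQuotient (Point G)

end EdgeTop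

namespace EdgeTop

open Filter Topology

variable {V : Type*} {G : SimpleGraph V}

/-! It suffices that every ultrafilter F on ETOP'(G) converges, as compactness passes to quotients.
If F contains the interior of an edge, compactness of [0,1] gives a limit on that closed edge.
Otherwise, for each finite S, the finitely many sets C ∪ Ω'(C) and the interiors of the edges in S
cover the space, so F selects one component of G - S. As E is countable, finite sets S_n exhaust it,
and the selected components C_n decrease. A vertex common to all C_n is a limit; if there is none,
`exists_ray_of_antitone_components` builds a ray with a tail in every C_n, and its edge-end is a
limit. -/

/-! ### Components after deleting finitely many edges -/

/-- Deleting finitely many edges from a connected graph leaves finitely many components. -/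
theorem finite_connectedComponent_deleteEdges (hG : G.Connected) {S : Set (Sym2 V)}
    (hS : S.Finite) : Finite (G.deleteEdges S).ConnectedComponent := by
  obtain ⟨v₀⟩ := hG.nonempty
  -- Every component meets `T`: on a walk from `v₀`, restart at the far end of each deleted edge.
  set T : Set V := insert v₀ (⋃ e ∈ S, {v | v ∈ e}) with hT
  have hTf : T.Finite := by
    refine (hS.biUnion fun e _ => ?_).insert v₀
    induction e with
    | h x y =>
      refine (Set.toFinite {x, y}).subset fun v hv => ?_
      simpa using hv
  have hreach : ∀ u v, G.Walk u v → (∃ t ∈ T, (G.deleteEdges S).Reachable t u) →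
      ∃ t ∈ T, (G.deleteEdges S).Reachable t v := by
    intro u v p
    induction p with
    | nil => exact id
    | @cons a b c hab _ ih =>
      rintro ⟨t, ht, hta⟩
      apply ih
      by_cases hmem : s(a, b) ∈ S
      · refine ⟨b, Or.inr ?_, SimpleGraph.Reachable.rfl⟩
        simp only [Set.mem_iUnion, Set.mem_ofPred_eq]
        exact ⟨_, hmem, Sym2.mem_mk_right a b⟩
      · exact ⟨t, ht, hta.trans
          (SimpleGraph.Adj.reachable (SimpleGraph.deleteEdges_adj.2 ⟨hab, hmem⟩))⟩
  have huniv : (G.deleteEdges S).connectedComponentMk '' T = Set.univ := by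
    refine Set.eq_univ_of_forall fun C => ?_
    induction C using SimpleGraph.ConnectedComponent.ind with
    | h v =>
      obtain ⟨p⟩ := hG.preconnected v₀ v
      obtain ⟨t, ht, htv⟩ := hreach v₀ v p ⟨v₀, Set.mem_insert _ _, SimpleGraph.Reachable.rfl⟩
      exact ⟨t, ht, SimpleGraph.ConnectedComponent.sound htv⟩
  exact Set.finite_univ_iff.1 (huniv ▸ hTf.image _)

/-- The part `C ∪ Ω'(C)` of the sets `C ∪ Ω'(C) ∪ E'(C)`. -/
def componentCore {S : Set (Sym2 V)} (C : (G.deleteEdges S).ConnectedComponent) :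
    Set (Point G) :=
  {p | match p with
    | Point.vertex v => v ∈ C.supp
    | Point.inner e _ => e.1 ∉ S ∧ vertexAtZero e ∈ C.supp
    | Point.edgeEnd w => ∃ r : Ray G, r.toEnd = w ∧ r.LiesIn C}

theorem componentCore_subset_componentOpen {S : Set (Sym2 V)}
    (C : (G.deleteEdges S).ConnectedComponent) (a b : G.edgeSet → Set.Ioo (0 : ℝ) 1) :
    componentCore C ⊆ componentOpen C a b := by
  rintro (v | ⟨e, t⟩ | w) h
  · exact h
  · exact Or.inl h
  · exact h

theorem vertexAtOne_mem_supp_iff {S : Set (Sym2 V)} (C : (G.deleteEdges S).ConnectedComponent)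
    {e : G.edgeSet} (he : e.1 ∉ S) : vertexAtOne e ∈ C.supp ↔ vertexAtZero e ∈ C.supp := by
  have hadj : (G.deleteEdges S).Adj (vertexAtZero e) (vertexAtOne e) := by
    rw [SimpleGraph.deleteEdges_adj, ← SimpleGraph.mem_edgeSet, mk_vertexAtZero_vertexAtOne]
    exact ⟨e.2, he⟩
  rw [SimpleGraph.ConnectedComponent.mem_supp_iff, SimpleGraph.ConnectedComponent.mem_supp_iff,
    SimpleGraph.ConnectedComponent.sound hadj.reachable]

theorem Ray.tail_zero (r : Ray G) : r.tail 0 = r := by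
  cases r
  simp [Ray.tail]

/-- Two rays of the same edge-end have a tail in the component that contains one of them. -/
theorem Ray.exists_tail_liesIn_of_toEnd_eq {r r' : Ray G} (h : r.toEnd = r'.toEnd)
    {S : Set (Sym2 V)} (hS : S.Finite) (hSG : S ⊆ G.edgeSet)
    {C : (G.deleteEdges S).ConnectedComponent} (hr : r.LiesIn C) :
    ∃ k, (r'.tail k).LiesIn C := by
  have hequiv : r.EdgeEquiv r' := Quotient.exact h
  obtain ⟨D, ⟨k, hk⟩, hl⟩ := hequiv S hS hSG
  obtain rfl : C = D := r.liesIn_unique (k := 0) (by rwa [r.tail_zero]) hk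
  exact hl

theorem exists_mem_supp_of_mem_componentCore {S S' : Set (Sym2 V)}
    (hS' : S'.Finite) (hSG' : S' ⊆ G.edgeSet) {C : (G.deleteEdges S).ConnectedComponent}
    {C' : (G.deleteEdges S').ConnectedComponent} {p : Point G}
    (h : p ∈ componentCore C) (h' : p ∈ componentCore C') : ∃ v ∈ C.supp, v ∈ C'.supp := by
  rcases p with v | ⟨e, t⟩ | w
  · exact ⟨v, h, h'⟩
  · exact ⟨_, h.2, h'.2⟩
  · obtain ⟨r, rfl, hr⟩ := h
    obtain ⟨r', hw, hr'⟩ := h'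
    obtain ⟨k, hk⟩ := Ray.exists_tail_liesIn_of_toEnd_eq hw hS' hSG' hr'
    exact ⟨_, hr.1 (k + 0), hk.1 0⟩

/-- Walks avoiding the larger set avoid the smaller, so one common vertex suffices. -/
theorem supp_subset_supp {S S' : Set (Sym2 V)} (hSS' : S ⊆ S')
    {C : (G.deleteEdges S).ConnectedComponent} {C' : (G.deleteEdges S').ConnectedComponent}
    (h : ∃ v ∈ C.supp, v ∈ C'.supp) : C'.supp ⊆ C.supp := by
  obtain ⟨v, hv, hv'⟩ := h
  intro u hu
  have huv : (G.deleteEdges S').Reachable u v :=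
    SimpleGraph.ConnectedComponent.exact (hu.trans hv'.symm)
  exact (SimpleGraph.ConnectedComponent.sound
    (huv.mono (SimpleGraph.deleteEdges_anti hSS'))).trans hv

/-! ### Construction of the ray -/

/-- Along a sequence of components that share no vertex and belong to increasing edge sets there is
a ray with a tail in each of them. -/
theorem exists_ray_of_antitone_components {S : ℕ → Set (Sym2 V)} (hmono : Monotone S)
    (C : ∀ n, (G.deleteEdges (S n)).ConnectedComponent)
    (hC : ∀ m n, m ≤ n → (C n).supp ⊆ (C m).supp) (huniv : (C 0).supp = Set.univ)
    (hempty : ∀ v, ∃ n, v ∉ (C n).supp) :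
    ∃ r : Ray G, ∀ n, ∃ k, (r.tail k).LiesIn (C n) := by
  have hlevel : ∀ v, ∃ n, v ∈ (C n).supp ∧ v ∉ (C (n + 1)).supp := by
    intro v
    by_contra! h
    obtain ⟨n, hn⟩ := hempty v
    refine hn ?_
    clear hn
    induction n with
    | zero => rw [huniv]; trivial
    | succ n ih => exact h n ih
  choose N hN hN' using hlevel
  have hne : ∀ n, ∃ v, v ∈ (C n).supp := fun n => (C n).nonempty_supp
  choose x hx using hne
  -- `N v` is the last level whose component contains `v`; `d v` is the distance, inside that
  -- component, to a target in the next one.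
  set d : V → ℕ := fun v => (G.deleteEdges (S (N v))).dist v (x (N v + 1)) with hd
  have hleN : ∀ {v n}, v ∈ (C n).supp → n ≤ N v := by
    intro v n hv
    by_contra! hlt
    exact hN' v (hC _ _ hlt hv)
  -- Take the first edge of a geodesic to the target: the level rises, or it stays and the distance
  -- drops.
  have hstep : ∀ u, ∃ v, (G.deleteEdges (S (N u))).Adj u v ∧
      (N u < N v ∨ N u = N v ∧ d v < d u) := by
    intro u
    have hxu : x (N u + 1) ∈ (C (N u)).supp := hC _ _ (Nat.le_succ _) (hx _)
    have hr : (G.deleteEdges (S (N u))).Reachable u (x (N u + 1)) :=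
      SimpleGraph.ConnectedComponent.exact ((hN u).trans hxu.symm)
    obtain ⟨p, hp⟩ := hr.exists_walk_length_eq_dist
    have hux : u ≠ x (N u + 1) := fun h => by
      have hx' := hx (N u + 1)
      rw [← h] at hx'
      exact hN' u hx'
    obtain ⟨v, huv, q, rfl⟩ := p.exists_eq_cons_of_ne hux
    have hv : v ∈ (C (N u)).supp :=
      (SimpleGraph.ConnectedComponent.sound huv.symm.reachable).trans (hN u)
    refine ⟨v, huv, (hleN hv).lt_or_eq.imp id fun h => ⟨h, ?_⟩⟩
    have hq := SimpleGraph.dist_le q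
    rw [SimpleGraph.Walk.length_cons] at hp
    simp only [hd, ← h]
    omega
  choose f hf hfd using hstep
  set u : ℕ → V := fun n => f^[n] (x 0) with hu
  have husucc : ∀ n, u (n + 1) = f (u n) := fun n => Function.iterate_succ_apply' f n _
  -- The lexicographic rank strictly increases, so no vertex repeats.
  have hlex : StrictMono fun n => toLex (N (u n), OrderDual.toDual (d (u n))) := by
    refine strictMono_nat_of_lt_succ fun n => ?_
    rw [Prod.Lex.toLex_lt_toLex, husucc]
    exact hfd (u n)
  have hNmono : Monotone fun n => N (u n) := by
    refine monotone_nat_of_le_succ fun n => ?_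
    rw [husucc]
    rcases hfd (u n) with h | h
    · exact h.le
    · exact h.1.le
  have hgrow : ∀ m n, d (u n) = m → ∃ k, N (u n) < N (u k) := by
    intro m
    induction m using Nat.strong_induction_on with
    | _ m ih =>
      rintro n rfl
      rcases hfd (u n) with h | ⟨h, h'⟩
      · exact ⟨n + 1, by rwa [husucc]⟩
      · rw [h, ← husucc]
        exact ih _ h' (n + 1) (by rw [husucc])
  have htop : ∀ n, ∃ k, n ≤ N (u k) := by
    intro n
    induction n with
    | zero => exact ⟨0, Nat.zero_le _⟩
    | succ n ih =>
      obtain ⟨k, hk⟩ := ih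
      obtain ⟨l, hl⟩ := hgrow _ k rfl
      exact ⟨l, by omega⟩
  have hadj : ∀ n, (G.deleteEdges (S (N (u n)))).Adj (u n) (u (n + 1)) := fun n => by
    rw [husucc]
    exact hf (u n)
  refine ⟨⟨u, fun i j hij => hlex.injective (by simp only [hij]),
    fun n => (SimpleGraph.deleteEdges_adj.1 (hadj n)).1⟩, fun n => ?_⟩
  obtain ⟨k, hk⟩ := htop n
  have hle : ∀ i, n ≤ N (u (k + i)) := fun i => hk.trans (hNmono (Nat.le_add_right k i))
  exact ⟨k, fun i => hC _ _ (hle i) (hN _),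
    fun i => SimpleGraph.deleteEdges_anti (hmono (hle i)) (hadj (k + i))⟩

/-! ### Convergence of ultrafilters -/

theorem exists_componentCore_mem (hG : G.Connected) (F : Ultrafilter (Point G))
    (hF : ∀ e : G.edgeSet, edgeOpen e Set.univ ∉ F) {S : Set (Sym2 V)} (hS : S.Finite) :
    ∃ C : (G.deleteEdges S).ConnectedComponent, componentCore C ∈ F := by
  have := finite_connectedComponent_deleteEdges hG hS
  have hS' : {e : G.edgeSet | e.1 ∈ S}.Finite := hS.preimage Subtype.val_injective.injOn
  have hcover : (⋃ C : (G.deleteEdges S).ConnectedComponent, componentCore C) ∪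
      ⋃ e ∈ {e : G.edgeSet | e.1 ∈ S}, edgeOpen e Set.univ = Set.univ := by
    refine Set.eq_univ_of_forall ?_
    rintro (v | ⟨e, t⟩ | w)
    · exact Or.inl (Set.mem_iUnion.2 ⟨(G.deleteEdges S).connectedComponentMk v, rfl⟩)
    · by_cases he : e.1 ∈ S
      · exact Or.inr (Set.mem_biUnion (show e ∈ {e : G.edgeSet | e.1 ∈ S} from he)
          ⟨t, trivial, rfl⟩)
      · exact Or.inl (Set.mem_iUnion.2
          ⟨(G.deleteEdges S).connectedComponentMk (vertexAtZero e), he, rfl⟩)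
    · induction w using Quotient.inductionOn with
      | h r =>
        obtain ⟨C, k, hk⟩ := r.exists_tail_liesIn hS
        -- Only a tail of `r` need lie in `C`; it represents the same end, since the two share a
        -- further tail.
        refine Or.inl (Set.mem_iUnion.2 ⟨C, r.tail k, Quotient.sound ?_, hk⟩)
        intro S' hS' _
        obtain ⟨D, l, hl⟩ := r.exists_tail_liesIn hS'
        refine ⟨D, ⟨l, ?_, ?_⟩, l, hl⟩
        · intro n
          have := hl.1 (k + n)
          simp only [Ray.tail] at this ⊢
          rwa [Nat.add_left_comm] at this
        · intro n
          have := hl.2 (k + n)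
          simp only [Ray.tail] at this ⊢
          rwa [Nat.add_left_comm, add_assoc k, Nat.add_left_comm l k (n + 1)] at this
  have huniv : (⋃ C : (G.deleteEdges S).ConnectedComponent, componentCore C) ∪
      ⋃ e ∈ {e : G.edgeSet | e.1 ∈ S}, edgeOpen e Set.univ ∈ F :=
    hcover ▸ univ_mem
  rcases Ultrafilter.union_mem_iff.1 huniv with h | h
  · rw [← Set.biUnion_univ, Ultrafilter.finite_biUnion_mem_iff Set.finite_univ] at h
    obtain ⟨C, -, hC⟩ := h
    exact ⟨C, hC⟩
  · rw [Ultrafilter.finite_biUnion_mem_iff hS'] at h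
    obtain ⟨e, -, he⟩ := h
    exact absurd he (hF e)

theorem le_nhds_of_forall_mem {F : Filter (Point G)} {p : Point G}
    (hedge : ∀ (e : G.edgeSet) (U : Set (Set.Ioo (0 : ℝ) 1)), IsOpen U → p ∈ edgeOpen e U →
      edgeOpen e U ∈ F)
    (hcomp : ∀ S : Set (Sym2 V), S.Finite → S ⊆ G.edgeSet →
      ∀ (C : (G.deleteEdges S).ConnectedComponent) (a b : G.edgeSet → Set.Ioo (0 : ℝ) 1),
        p ∈ componentOpen C a b → componentOpen C a b ∈ F) : F ≤ 𝓝 p := by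
  rw [TopologicalSpace.nhds_generateFrom]
  refine le_iInf₂ fun s hs => le_principal_iff.2 ?_
  rcases hs with ⟨hp, ⟨e, U, hU, rfl⟩ | ⟨S, hS, hSG, C, a, b, rfl⟩⟩
  · exact hedge e U hU hp
  · exact hcomp S hS hSG C a b hp

/-- An ultrafilter that contains the interior of an edge converges to a point of this edge. -/
theorem exists_le_nhds_of_edgeOpen_mem {F : Ultrafilter (Point G)} {e : G.edgeSet}
    (he : edgeOpen e Set.univ ∈ F) : ∃ p : Point G, ↑F ≤ 𝓝 p := by
  -- The value 0 is never used: all arguments are restricted to the interior of `e`.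
  let param : Point G → ℝ := fun p => match p with
    | Point.inner _ t => t.1
    | _ => 0
  have hIcc : Set.Icc (0 : ℝ) 1 ∈ F.map param := by
    refine Ultrafilter.mem_map.2 (mem_of_superset he ?_)
    rintro _ ⟨t, -, rfl⟩
    exact ⟨t.2.1.le, t.2.2.le⟩
  obtain ⟨x, hx, hlim⟩ := isCompact_Icc.ultrafilter_le_nhds' _ hIcc
  replace hlim : Tendsto param F (𝓝 x) := hlim
  have hmem : ∀ {A : Set ℝ} {B : Set (Point G)}, A ∈ 𝓝 x →
      (∀ t : Set.Ioo (0 : ℝ) 1, t.1 ∈ A → Point.inner e t ∈ B) → B ∈ F := by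
    intro A B hA hB
    refine mem_of_superset (inter_mem he (hlim hA)) ?_
    rintro _ ⟨⟨t, -, rfl⟩, ht⟩
    exact hB t ht
  rcases hx.1.eq_or_lt with rfl | h0
  · refine ⟨Point.vertex (vertexAtZero e), le_nhds_of_forall_mem ?_ ?_⟩
    · rintro _ _ _ ⟨_, _, h⟩
      cases h
    · intro S _ _ C a b hp
      refine hmem (Iio_mem_nhds (a e).2.1) fun t ht => ?_
      by_cases heS : e.1 ∈ S
      · exact Or.inr ⟨heS, Or.inl ⟨hp, ht⟩⟩
      · exact Or.inl ⟨heS, hp⟩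
  rcases hx.2.eq_or_lt with rfl | h1
  · refine ⟨Point.vertex (vertexAtOne e), le_nhds_of_forall_mem ?_ ?_⟩
    · rintro _ _ _ ⟨_, _, h⟩
      cases h
    · intro S _ _ C a b hp
      refine hmem (Ioi_mem_nhds (b e).2.2) fun t ht => ?_
      by_cases heS : e.1 ∈ S
      · exact Or.inr ⟨heS, Or.inr ⟨hp, ht⟩⟩
      · exact Or.inl ⟨heS, (vertexAtOne_mem_supp_iff C heS).1 hp⟩
  · refine ⟨Point.inner e ⟨x, h0, h1⟩, le_nhds_of_forall_mem ?_ ?_⟩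
    · rintro e' U hU ⟨t, ht, h⟩
      cases h
      refine hmem ((isOpen_Ioo.isOpenEmbedding_subtypeVal.isOpen_iff_image_isOpen.1 hU).mem_nhds
        ⟨_, ht, rfl⟩) ?_
      rintro t ⟨t', ht', h⟩
      exact ⟨t, Subtype.ext h ▸ ht', rfl⟩
    · rintro S _ _ C a b (hp | ⟨heS, ⟨hC, hlt⟩ | ⟨hC, hlt⟩⟩)
      · exact hmem univ_mem fun t _ => Or.inl hp
      · exact hmem (Iio_mem_nhds (show x < (a e).1 from hlt)) fun t ht =>
          Or.inr ⟨heS, Or.inl ⟨hC, ht⟩⟩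
      · exact hmem (Ioi_mem_nhds (show (b e).1 < x from hlt)) fun t ht =>
          Or.inr ⟨heS, Or.inr ⟨hC, ht⟩⟩

/-- In a countable connected graph, an ultrafilter that contains no interior of an edge converges to
a vertex or an edge-end. -/
theorem exists_le_nhds_of_edgeOpen_notMem [Countable V] (hG : G.Connected)
    {F : Ultrafilter (Point G)} (hF : ∀ e : G.edgeSet, edgeOpen e Set.univ ∉ F) :
    ∃ p : Point G, ↑F ≤ 𝓝 p := by
  have : Countable (Sym2 V) := Quotient.countable
  obtain ⟨g, hg⟩ := Countable.exists_injective_nat (Sym2 V)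
  set S : ℕ → Set (Sym2 V) := fun n => {e | e ∈ G.edgeSet ∧ g e < n} with hSdef
  have hSfin : ∀ n, (S n).Finite := fun n =>
    ((Set.finite_lt_nat n).preimage hg.injOn).subset fun e he => he.2
  have hSG : ∀ n, S n ⊆ G.edgeSet := fun n e he => he.1
  have hmono : Monotone S := fun m n hmn e he => ⟨he.1, he.2.trans_le hmn⟩
  have hcofinal : ∀ T : Set (Sym2 V), T.Finite → T ⊆ G.edgeSet → ∃ n, T ⊆ S n := by
    intro T hT hTG
    obtain ⟨n, hn⟩ := (hT.image g).bddAbove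
    exact ⟨n + 1, fun e he => ⟨hTG he, Nat.lt_succ_of_le (hn ⟨e, he, rfl⟩)⟩⟩
  choose C hCF using fun n => exists_componentCore_mem hG F hF (hSfin n)
  have hinter : ∀ {T : Set (Sym2 V)} {D : (G.deleteEdges T).ConnectedComponent},
      componentCore D ∈ F → ∀ n, ∃ v ∈ D.supp, v ∈ (C n).supp := by
    intro T D hD n
    obtain ⟨p, hp, hp'⟩ := F.nonempty_of_mem (inter_mem hD (hCF n))
    exact exists_mem_supp_of_mem_componentCore (hSfin n) (hSG n) hp hp'
  have hanti : ∀ m n, m ≤ n → (C n).supp ⊆ (C m).supp := fun m n hmn =>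
    supp_subset_supp (hmono hmn) (hinter (hCF m) n)
  -- Convergence becomes combinatorial: once `T ⊆ S n`, the component of G - T selected by `F`
  -- contains `C n`, so it is `D` as soon as `D` meets `C n`.
  have hopen : ∀ {T : Set (Sym2 V)}, T.Finite → T ⊆ G.edgeSet →
      ∀ (D : (G.deleteEdges T).ConnectedComponent) (a b : G.edgeSet → Set.Ioo (0 : ℝ) 1),
      (∀ n, ∃ v ∈ D.supp, v ∈ (C n).supp) → componentOpen D a b ∈ F := by
    intro T hT hTG D a b hD
    obtain ⟨D', hD'⟩ := exists_componentCore_mem hG F hF hT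
    obtain ⟨n, hn⟩ := hcofinal T hT hTG
    obtain ⟨v, hv, hv'⟩ := hD n
    obtain rfl : D' = D := ((supp_subset_supp hn (hinter hD' n)) hv').symm.trans hv
    exact mem_of_superset hD' (componentCore_subset_componentOpen _ a b)
  by_cases hvert : ∃ v, ∀ n, v ∈ (C n).supp
  · obtain ⟨v, hv⟩ := hvert
    refine ⟨Point.vertex v, le_nhds_of_forall_mem ?_ ?_⟩
    · rintro _ _ _ ⟨_, _, h⟩
      cases h
    · exact fun T hT hTG D a b hp => hopen hT hTG D a b fun n => ⟨v, hp, hv n⟩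
  · push Not at hvert
    have huniv : (C 0).supp = Set.univ := by
      refine Set.eq_univ_of_forall fun v => ?_
      obtain ⟨u, hu⟩ := (C 0).nonempty_supp
      have h0 : S 0 = ∅ := by simp [hSdef]
      have hr : (G.deleteEdges (S 0)).Reachable v u := by
        rw [h0, SimpleGraph.deleteEdges_empty]
        exact hG.preconnected v u
      exact (SimpleGraph.ConnectedComponent.sound hr).trans hu
    obtain ⟨r, hr⟩ := exists_ray_of_antitone_components hmono C hanti huniv hvert
    refine ⟨Point.edgeEnd r.toEnd, le_nhds_of_forall_mem ?_ ?_⟩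
    · rintro _ _ _ ⟨_, _, h⟩
      cases h
    · rintro T hT hTG D a b ⟨r', hr', hD⟩
      refine hopen hT hTG D a b fun n => ?_
      obtain ⟨k, hk⟩ := hr n
      obtain ⟨l, hl⟩ := Ray.exists_tail_liesIn_of_toEnd_eq hr' hT hTG hD
      refine ⟨r.vert (k + l), ?_, hk.1 l⟩
      rw [add_comm]
      exact hl.1 k

theorem compactSpace_point [Countable V] (hG : G.Connected) : CompactSpace (Point G) := by
  refine ⟨isCompact_iff_ultrafilter_le_nhds.2 fun F _ => ?_⟩
  have h : ∃ p : Point G, ↑F ≤ 𝓝 p := by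
    by_cases hF : ∃ e : G.edgeSet, edgeOpen e Set.univ ∈ F
    · obtain ⟨e, he⟩ := hF
      exact exists_le_nhds_of_edgeOpen_mem he
    · exact exists_le_nhds_of_edgeOpen_notMem hG (not_exists.1 hF)
  obtain ⟨p, hp⟩ := h
  exact ⟨p, trivial, hp⟩

end EdgeTop

theorem mainTheorem9 {V : Type*} [Countable V] (G : SimpleGraph V) (hG : G.Connected) :
    CompactSpace (EdgeTop.ETOP G) := by
  have := EdgeTop.compactSpace_point hG
  exact Quotient.compactSpace
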